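/- Consider a shared-memory switch with $N\in\mathbb{N}$ output ports and a buffer that can hold at most $M\in\mathbb{N}$ packets in total; initially the buffer is empty. In each time step $t=0,1,2,\dots$ an arbitrary finite sequence of unit-value packets arrives, one after the other, each destined for one output port. Upon the arrival of a packet, a buffer management algorithm either rejects it irrevocably or accepts it, possibly evicting previously accepted packets, such that at most $M$ packets are stored. At the end of each time step, every output port for which at least one packet is stored transmits one such packet. The throughput is the total number of packets transmitted over all time steps. Longest Queue Drop (LQD) accepts every arriving packet, and if the buffer then contains more than $M$ packets, it drops one packet from a queue that is currently longest (the arriving packet being counted as part of its queue), with ties broken arbitrarily. Theorem. LQD is $1.707$-competitive. More precisely, for all $N$ and $M$, every input sequence, and every (possibly adversarial) way of breaking ties, $$\mathrm{OPT}\le\Bigl(1+\frac1\rho\Bigr)\cdot\mathrm{LQD},\qquad \rho=1.41478,$$ where $\mathrm{LQD}$ is the throughput of LQD and $\mathrm{OPT}$ is the maximum throughput (the supremum, possibly infinite, if the input is infinite) of any offline algorithm with the same buffer size on the same input. Moreover, $1+\frac1\rho\le 1.70683<1+\frac1{\sqrt2}$. -/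

import Mathlib

open scoped ENNReal

namespace SharedMemorySwitch

/-- A buffer configuration of a switch whose output ports form the type `Q`: the number of packets
currently stored for each port. Packets have unit value, so packets for the same port are
interchangeable and only the queue lengths matter. -/
abbrev Buffer (Q : Type) := Q → ℕ

/-- An input instance: for every time step, the packets arriving in this step in order of arrival,
each given by the output port it is destined to. -/
abbrev Instance (Q : Type) := ℕ → List Q

/-- How a buffer management policy may treat a single arriving packet: `R s q s'` says that, when
the buffer is `s` and a packet for port `q` arrives, the policy may change the buffer to `s'`. -/
abbrev AdmissionRule (Q : Type) := Buffer Q → Q → Buffer Q → Prop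

section
variable {Q : Type}

/-- The buffer `s` together with one more packet for port `q`. -/
def add [DecidableEq Q] (s : Buffer Q) (q : Q) : Buffer Q := s + Pi.single q 1

/-- The buffer `s` with one packet for port `q` removed. -/
def drop [DecidableEq Q] (s : Buffer Q) (q : Q) : Buffer Q := s - Pi.single q 1

/-- What any (offline) policy may do with a packet arriving for port `q`: reject it or accept it,
and evict previously accepted packets, provided that at most `M` packets remain in the buffer. -/
def feasible [Fintype Q] [DecidableEq Q] (M : ℕ) : AdmissionRule Q :=
  fun s q s' => s' ≤ add s q ∧ ∑ p, s' p ≤ M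

/-- Longest Queue Drop: the packet is accepted; if the buffer then holds more than `M` packets, one
packet is dropped from some longest queue (the arriving packet being counted). Ties may be broken in
an arbitrary way. -/
def lqd [Fintype Q] [DecidableEq Q] (M : ℕ) : AdmissionRule Q :=
  fun s q s' =>
    (∑ p, add s q p ≤ M ∧ s' = add s q) ∨
    (M < ∑ p, add s q p ∧ ∃ r, (∀ p, add s q p ≤ add s q r) ∧ s' = drop (add s q) r)

/-- `Admit R s l s'`: treating the packets of the list `l` one after the other according to `R` may
change the buffer from `s` to `s'`. -/
inductive Admit (R : AdmissionRule Q) : Buffer Q → List Q → Buffer Q → Prop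
  | nil (s : Buffer Q) : Admit R s [] s
  | cons {s s' s'' : Buffer Q} {q : Q} {l : List Q} :
      R s q s' → Admit R s' l s'' → Admit R s (q :: l) s''

/-- The transmission phase: every port with a nonempty queue transmits one packet. -/
def transmit (s : Buffer Q) : Buffer Q := fun q => s q - 1

/-- `IsRun R I b`: starting with an empty buffer, the sequence `b` is a possible evolution of the
buffer under the rule `R` on the instance `I`. Here `b t` is the buffer in time step `t` after all
arrivals, rejections and evictions of this step and before its transmission phase. -/
def IsRun (R : AdmissionRule Q) (I : Instance Q) (b : ℕ → Buffer Q) : Prop :=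
  Admit R 0 (I 0) (b 0) ∧ ∀ t, Admit R (transmit (b t)) (I (t + 1)) (b (t + 1))

/-- The total number of packets transmitted during a run, over all time steps. -/
noncomputable def throughput [Fintype Q] (b : ℕ → Buffer Q) : ℝ≥0∞ :=
  ∑' t, ((Finset.univ.filter fun q => 0 < b t q).card : ℝ≥0∞)

/-- The throughput of an optimal offline algorithm with buffer size `M` on the instance `I`. -/
noncomputable def opt [Fintype Q] [DecidableEq Q] (M : ℕ) (I : Instance Q) : ℝ≥0∞ :=
  ⨆ (b : ℕ → Buffer Q) (_ : IsRun (feasible M) I b), throughput b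

end

/-- Longest Queue Drop is `c`-competitive: for every number `N` of output ports, every buffer size
`M`, every instance, and every way of breaking ties (every possible run of the algorithm), the
optimal throughput is at most `c` times that of Longest Queue Drop. -/
def LQDCompetitive (c : ℝ) : Prop :=
  1 ≤ c ∧ ∀ (N M : ℕ) (I : Instance (Fin N)) (b : ℕ → Buffer (Fin N)),
    IsRun (lqd M) I b → opt M I ≤ ENNReal.ofReal c * throughput b

end SharedMemorySwitch

namespace SharedMemorySwitch

/-! ### Admission under LQD: a drop leaves the buffer full and balanced. -/

section Admission
variable {Q : Type}

theorem Admit.le_add_count [DecidableEq Q] {R : AdmissionRule Q}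
    (hR : ∀ s q s', R s q s' → s' ≤ add s q) {s s' : Buffer Q} {I : List Q}
    (h : Admit R s I s') (p : Q) : s' p ≤ s p + I.count p := by
  induction h with
  | nil s => simp
  | @cons s s₁ s' q I h₁ _ ih =>
    have h₂ : s₁ p ≤ add s q p := hR _ _ _ h₁ p
    have h₃ : add s q p = s p + (if q = p then 1 else 0) := by
      simp [add, Pi.single_apply, eq_comm]
    rw [List.count_cons]
    simp only [beq_iff_eq]
    omega

variable [DecidableEq Q]

theorem add_apply_self (s : Buffer Q) (q : Q) : add s q q = s q + 1 := by
  simp [add]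

theorem add_apply_of_ne (s : Buffer Q) {p q : Q} (h : p ≠ q) : add s q p = s p := by
  simp [add, h]

theorem drop_apply_self (s : Buffer Q) (q : Q) : drop s q q = s q - 1 := by
  simp [drop]

theorem drop_apply_of_ne (s : Buffer Q) {p q : Q} (h : p ≠ q) : drop s q p = s p := by
  simp [drop, h]

theorem drop_le (s : Buffer Q) (q : Q) : drop s q ≤ s := fun p => by
  by_cases h : p = q
  · subst h; simp [drop]
  · simp [drop, h]

theorem longest_pos {s : Buffer Q} {q r : Q} (h : ∀ p, add s q p ≤ add s q r) :
    0 < add s q r := by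
  have := h q
  rw [add_apply_self] at this
  omega

variable [Fintype Q]

theorem sum_add (s : Buffer Q) (q : Q) : ∑ p, add s q p = ∑ p, s p + 1 := by
  simp [add, Finset.sum_add_distrib]

theorem sum_drop (s : Buffer Q) {q : Q} (h : 0 < s q) : ∑ p, drop s q p + 1 = ∑ p, s p := by
  have : s = add (drop s q) q := by
    funext p
    by_cases hp : p = q
    · subst hp
      rw [add_apply_self, drop_apply_self]
      omega
    · rw [add_apply_of_ne _ hp, drop_apply_of_ne _ hp]
  conv_rhs => rw [this, sum_add]

theorem feasible_le {M : ℕ} (s : Buffer Q) (q : Q) (s' : Buffer Q) (h : feasible M s q s') :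
    s' ≤ add s q := h.1

theorem lqd_sum {M : ℕ} {s : Buffer Q} {q : Q} {s' : Buffer Q} (h : lqd M s q s')
    (hs : ∑ p, s p ≤ M) :
    (∑ p, s' p = ∑ p, s p + 1 ∧ ∑ p, s' p ≤ M) ∨ (∑ p, s' p = M ∧ ∑ p, s p = M) := by
  have h₁ := sum_add s q
  rcases h with ⟨h₀, rfl⟩ | ⟨h₀, r, hr, rfl⟩
  · left; exact ⟨h₁, h₀⟩
  · right
    have := sum_drop _ (longest_pos hr)
    omega

theorem Admit.lqd_sum_le {M : ℕ} {s s' : Buffer Q} {I : List Q} (h : Admit (lqd M) s I s')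
    (hs : ∑ p, s p ≤ M) : ∑ p, s' p ≤ M := by
  induction h with
  | nil s => exact hs
  | cons h₁ _ ih =>
    apply ih
    rcases lqd_sum h₁ hs with h | h <;> omega

theorem Admit.feasible_sum_le {M : ℕ} {s s' : Buffer Q} {I : List Q}
    (h : Admit (feasible M) s I s') (hs : ∑ p, s p ≤ M) : ∑ p, s' p ≤ M := by
  induction h with
  | nil s => exact hs
  | cons h₁ _ ih => exact ih h₁.2

/-- A full buffer stays full under Longest Queue Drop, and its longest queue does not grow. -/
theorem Admit.lqd_full {M K : ℕ} {s s' : Buffer Q} {I : List Q} (h : Admit (lqd M) s I s')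
    (hs : ∑ p, s p = M) (hK : ∀ p, s p ≤ K) : ∑ p, s' p = M ∧ ∀ p, s' p ≤ K := by
  induction h with
  | nil s => exact ⟨hs, hK⟩
  | @cons s s₁ s' q I h₁ _ ih =>
    have hsum : ∑ p, s₁ p = M := by
      rcases lqd_sum h₁ hs.le with h | h <;> omega
    refine ih hsum fun p => ?_
    rcases h₁ with ⟨h₀, rfl⟩ | ⟨_, r, hr, rfl⟩
    · rw [sum_add] at h₀; omega
    · by_cases hq : s q + 1 ≤ K
      · refine (drop_le _ _ p).trans ?_
        by_cases hp : p = q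
        · subst hp; rwa [add_apply_self]
        · rw [add_apply_of_ne _ hp]; exact hK p
      · have hrq : r = q := by
          by_contra hne
          have h₂ := hr q
          rw [add_apply_self, add_apply_of_ne _ hne] at h₂
          have := hK r
          omega
        subst hrq
        by_cases hp : p = r
        · subst hp
          rw [drop_apply_self, add_apply_self]
          have := hK p
          omega
        · rw [drop_apply_of_ne _ hp, add_apply_of_ne _ hp]; exact hK p

/-- If Longest Queue Drop drops some packet for port `q` in an arrival phase, then afterwards the
buffer is full and no queue is longer than the one for `q` by more than one packet. -/
theorem Admit.lqd_dropped {M : ℕ} {s s' : Buffer Q} {I : List Q} (h : Admit (lqd M) s I s')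
    (hs : ∑ p, s p ≤ M) {q : Q} (hq : s' q < s q + I.count q) :
    ∑ p, s' p = M ∧ ∀ p, s' p ≤ s' q + 1 := by
  induction h with
  | nil s => simp at hq
  | @cons s s₁ s' a I h₁ h₂ ih =>
    have hs₁ : ∑ p, s₁ p ≤ M := by
      rcases lqd_sum h₁ hs with h | h <;> omega
    by_cases hlt : s' q < s₁ q + I.count q
    · exact ih hs₁ hlt
    · have hlt₁ : s₁ q < add s a q := by
        have h₃ : add s a q = s q + (if a = q then 1 else 0) := by
          simp [add, Pi.single_apply, eq_comm]
        rw [List.count_cons] at hq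
        simp only [beq_iff_eq] at hq
        omega
      rcases h₁ with ⟨h₀, rfl⟩ | ⟨h₀, r, hr, rfl⟩
      · exact absurd hlt₁ (lt_irrefl _)
      · have hrq : q = r := by
          by_contra hne
          rw [drop_apply_of_ne _ hne] at hlt₁
          exact absurd hlt₁ (lt_irrefl _)
        subst hrq
        have hpos := longest_pos hr
        have hsum := sum_drop _ hpos
        have hadd := sum_add s a
        have hle : ∀ p, drop (add s a) q p ≤ drop (add s a) q q + 1 := fun p => by
          refine (drop_le _ _ p).trans ((hr p).trans ?_)
          rw [drop_apply_self]
          omega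
        -- No later packet for `q` is dropped, so its queue does not shrink any more, while the
        -- bound just reached persists for the others.
        obtain ⟨hM, hK⟩ := h₂.lqd_full (by omega) hle
        refine ⟨hM, fun p => (hK p).trans ?_⟩
        omega

/-- Serves to exclude arrivals once LQD has fallen silent: a nonempty buffer stays nonempty during
the arrival phase. -/
theorem Admit.lqd_count {M : ℕ} {s s' : Buffer Q} {I : List Q} (h : Admit (lqd M) s I s')
    (hs : ∑ p, s p ≤ M) (hM : 0 < M) (hI : I ≠ []) : 0 < ∑ p, s' p := by
  have key : ∀ {s s' : Buffer Q} {I : List Q}, Admit (lqd M) s I s' → ∑ p, s p ≤ M →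
      0 < ∑ p, s p → 0 < ∑ p, s' p := by
    intro s s' I h
    induction h with
    | nil s => exact fun _ h => h
    | cons h₁ _ ih =>
      intro h₂ h₃
      rcases lqd_sum h₁ h₂ with h | h <;> exact ih (by omega) (by omega)
  cases h with
  | nil => exact absurd rfl hI
  | cons h₁ h₂ =>
    rcases lqd_sum h₁ hs with h | h <;> exact key h₂ (by omega) (by omega)

end Admission


/-! ### Real inequalities: what one extra and one era collect. -/

section Numerics
open Finset

/-- The sum of a monotone function over a set of natural numbers that are at least `a` is smallest
if the set is an interval starting in `a`. -/
theorem sum_range_add_le_sum {f : ℕ → ℝ} (a : ℕ) (hf : ∀ m n, a ≤ m → m ≤ n → f m ≤ f n)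
    (s : Finset ℕ) (hs : ∀ n ∈ s, a ≤ n) : ∑ k ∈ range s.card, f (a + k) ≤ ∑ n ∈ s, f n := by
  induction s using Finset.induction_on_max with
  | empty => simp
  | insert m s hm ih =>
    have hnot : m ∉ s := fun h => lt_irrefl _ (hm m h)
    rw [card_insert_of_notMem hnot, sum_range_succ, sum_insert hnot, add_comm]
    refine add_le_add (hf _ _ (Nat.le_add_right _ _) ?_)
      (ih fun n hn => hs n (mem_insert_of_mem hn))
    have hsub : s ⊆ Ico a m := fun n hn => mem_Ico.2 ⟨hs n (mem_insert_of_mem hn), hm n hn⟩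
    have := card_le_card hsub
    rw [Nat.card_Ico] at this
    have := hs m (mem_insert_self _ _)
    omega

/-- A lower bound for the total rate collected over a period during which the level `y` rises only
against payment. -/
theorem collected_ge {y w : ℕ → ℝ} {t d : ℕ} {L : ℝ} (htd : t < d) (hL : 0 < L)
    (hy : ∀ s, t ≤ s → s ≤ d → 0 < y s) (hyL : y t ≤ L) 
    (hw : ∀ s, t ≤ s → s < d → 0 ≤ w s)
    (hstep : ∀ s, t ≤ s → s < d → Real.log (y (s + 1)) - Real.log (y s) ≤ w s) :
    1 / L + 1 / 2 + 1 / 2 * Real.log (2 * ((d : ℝ) - t) / L) ≤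
      ∑ s ∈ Icc t d, 1 / y s + 1 / 2 * ∑ s ∈ Ico t d, w s := by
  obtain ⟨m, hm, hmax⟩ := exists_max_image (Icc t d) y ⟨t, mem_Icc.2 ⟨le_rfl, htd.le⟩⟩
  rw [mem_Icc] at hm
  have hym := hy m hm.1 hm.2
  have htele : ∀ r, t ≤ r → r ≤ d → Real.log (y r) - Real.log (y t) ≤ ∑ s ∈ Ico t r, w s := by
    intro r hr
    induction r, hr using Nat.le_induction with
    | base => simp
    | succ r hr ih =>
      intro hrd
      rw [sum_Ico_succ_top hr]
      have h₁ := ih (by omega)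
      have h₂ := hstep r hr (by omega)
      linarith
  have hlog : Real.log (y m / L) ≤ ∑ s ∈ Ico t d, w s := by
    rw [Real.log_div hym.ne' hL.ne']
    have h₁ := htele m hm.1 hm.2
    have h₂ : ∑ s ∈ Ico t m, w s ≤ ∑ s ∈ Ico t d, w s :=
      sum_le_sum_of_subset_of_nonneg (Ico_subset_Ico_right hm.2) fun s hs _ =>
        hw s (mem_Ico.1 hs).1 (mem_Ico.1 hs).2
    have h₃ := Real.log_le_log (hy t le_rfl htd.le) hyL
    linarith
  have hdt : (0 : ℝ) < (d : ℝ) - t := sub_pos.2 (by exact_mod_cast htd)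
  have hrate : 1 / L + ((d : ℝ) - t) / y m ≤ ∑ s ∈ Icc t d, 1 / y s := by
    rw [← Finset.Ioc_insert_left htd.le, sum_insert (by simp)]
    refine add_le_add (one_div_le_one_div_of_le (hy t le_rfl htd.le) hyL) ?_
    calc ((d : ℝ) - t) / y m = ∑ s ∈ Ioc t d, 1 / y m := by
          rw [sum_const, Nat.card_Ioc, nsmul_eq_mul, Nat.cast_sub htd.le]; ring
      _ ≤ _ := sum_le_sum fun s hs => by
          rw [mem_Ioc] at hs
          exact one_div_le_one_div_of_le (hy s hs.1.le hs.2) (hmax s (mem_Icc.2 ⟨hs.1.le, hs.2⟩))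
  have hz : 0 < 2 * ((d : ℝ) - t) / y m := by positivity
  -- The total is at least 1/L + (d - t)/y m + 1/2 log(y m / L), which is minimal in the peak `y m`
  -- at y m = 2(d - t). Applying log x ≤ x - 1 to x = 2(d - t)/y m eliminates the peak.
  have hopt := Real.log_le_sub_one_of_pos hz
  have hsplit : Real.log (2 * ((d : ℝ) - t) / L) =
      Real.log (2 * ((d : ℝ) - t) / y m) + Real.log (y m / L) := by
    rw [← Real.log_mul hz.ne' (by positivity)]
    congr 1
    field_simp
  have : 2 * ((d : ℝ) - t) / y m = 2 * (((d : ℝ) - t) / y m) := by ring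
  rw [hsplit]
  linarith

/-- The tangent at `w` to the convex function u log u. -/
theorem mul_log_ge {u w : ℝ} (hu : 0 < u) (hw : 0 < w) :
    u * Real.log w + u - w ≤ u * Real.log u := by
  have h := Real.log_le_sub_one_of_pos (div_pos hw hu)
  rw [Real.log_div hw.ne' hu.ne'] at h
  have := mul_le_mul_of_nonneg_left h hu.le
  have h₂ : u * (w / u - 1) = w - u := by field_simp
  nlinarith

/-- The left side is the integral of log(1 + k/L) over 0 ≤ k ≤ z; the inductive step is a tangent
inequality. -/
theorem sum_log_ge {L : ℝ} (hL : 0 < L) (z : ℕ) :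
    (L + z) * Real.log (1 + z / L) - z ≤ ∑ k ∈ range (z + 1), Real.log (1 + k / L) := by
  induction z with
  | zero => simp
  | succ z ih =>
    rw [sum_range_succ]
    have hu : 0 < 1 + (z : ℝ) / L := by positivity
    have hw : 0 < 1 + ((z + 1 : ℕ) : ℝ) / L := by positivity
    have h := mul_log_ge hu hw
    have h₁ := mul_le_mul_of_nonneg_left h hL.le
    have e₁ : L * (1 + (z : ℝ) / L) = L + z := by field_simp
    have e₂ : L * (1 + ((z + 1 : ℕ) : ℝ) / L) = L + (z + 1) := by push_cast; field_simp
    have h₂ : (L + z) * Real.log (1 + ((z + 1 : ℕ) : ℝ) / L) + (L + z) - (L + (z + 1)) ≤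
        (L + z) * Real.log (1 + (z : ℝ) / L) := by
      rw [← e₁, ← e₂]; linarith
    push_cast at h₂ ⊢
    linarith

/-- The queue that has `L` packets when its last packet is dropped, together with the extra packets
that are transmitted afterwards, collects enough. -/
theorem era_bound {L x : ℕ} (hL : 0 < L) :
    1.41478 * (x : ℝ) ≤ ∑ k ∈ range x,
      (1 / (L : ℝ) + 1 / 2 + 1 / 2 * Real.log (2 * ((L : ℝ) + k) / L)) + 1 / 2 * ((L : ℝ) - 1) := by
  have hL1 : (1 : ℝ) ≤ L := by exact_mod_cast hL
  have hL0 : (0 : ℝ) < L := by linarith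
  rcases x with _ | z
  · simp; linarith
  have hsum : ∑ k ∈ range (z + 1),
      (1 / (L : ℝ) + 1 / 2 + 1 / 2 * Real.log (2 * ((L : ℝ) + k) / L)) =
      ((z : ℝ) + 1) * (1 / (L : ℝ) + 1 / 2 + 1 / 2 * Real.log 2) +
        1 / 2 * ∑ k ∈ range (z + 1), Real.log (1 + k / L) := by
    have h : ∀ k ∈ range (z + 1),
        1 / (L : ℝ) + 1 / 2 + 1 / 2 * Real.log (2 * ((L : ℝ) + k) / L) =
        (1 / (L : ℝ) + 1 / 2 + 1 / 2 * Real.log 2) + 1 / 2 * Real.log (1 + k / L) := fun k _ => by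
      have : 2 * ((L : ℝ) + k) / L = 2 * (1 + k / L) := by field_simp
      rw [this, Real.log_mul two_ne_zero (by positivity)]
      ring
    rw [sum_congr rfl h, sum_add_distrib, sum_const, card_range, nsmul_eq_mul, mul_sum]
    push_cast
    rfl
  rw [hsum]
  have hlog := sum_log_ge hL0 z
  have hlog2 := Real.log_two_gt_d9
  set y : ℝ := (z : ℝ) / L with hy
  have hy0 : 0 ≤ y := by positivity
  have hzy : (z : ℝ) = L * y := by rw [hy]; field_simp
  have hmul : ∀ w : ℝ, 0 < w → L * ((1 + y) * Real.log w + 1 + y - w) ≤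
      (L + z) * Real.log (1 + y) := fun w hw => by
    have := mul_le_mul_of_nonneg_left (mul_log_ge (by positivity : 0 < 1 + y) hw) hL0.le
    rw [hzy]
    nlinarith
  have hinv : 0 < 1 / (L : ℝ) := by positivity
  have hzi : (z : ℝ) * (1 / (L : ℝ)) = y := by rw [hy]; ring
  have hz0 : (0 : ℝ) ≤ z := by positivity
  push_cast
  -- For large L the ratio is smallest at y = 1 + log(1 + y) ≈ 2.146, where it is about 1.4197; the
  -- tangent at 25/8 is nearly sharp there. The terms of lower order in L are about y + 1/L -
  -- 1.0682, hence positive beyond 107/100. Below, the tangent at 3/2 leaves enough slack in the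
  -- term linear in L.
  rcases le_or_gt y (107 / 100) with hy1 | hy1
  · have h32 : (2 / 5 : ℝ) ≤ Real.log (3 / 2) := by
      have := Real.le_log_one_add_of_nonneg (x := 1 / 2) (by norm_num)
      norm_num at this ⊢
      linarith
    have h₁ := hmul (3 / 2) (by norm_num)
    have h₂ : L * ((1 + y) * (2 / 5) + 1 + y - 3 / 2) ≤
        L * ((1 + y) * Real.log (3 / 2) + 1 + y - 3 / 2) := by gcongr
    have hlz := mul_le_mul_of_nonneg_left hlog2.le hz0
    -- reduce to an inequality between `L`, `y` and `1 / L`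
    have hamgm : 2 - (L : ℝ) ≤ 1 / L := by
      rw [le_div_iff₀ hL0]; nlinarith [sq_nonneg ((L : ℝ) - 1)]
    have hgoal : 0 ≤ (L : ℝ) * (45 / 100 - 36822 / 100000 * y) + y + 1 / L - 1.068211 := by
      rcases le_or_gt (L : ℝ) 1 with h | h
      · have : (L : ℝ) = 1 := le_antisymm h hL1
        rw [this]; norm_num; linarith
      · have hL2 : (2 : ℝ) ≤ L := by
          have : 1 < L := by exact_mod_cast h
          exact_mod_cast this
        have hc : 0 ≤ 45 / 100 - 36822 / 100000 * y := by linarith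
        rcases hL2.eq_or_lt with h2 | h2
        · rw [← h2]; norm_num; linarith
        · have hL3 : (3 : ℝ) ≤ L := by
            have : 2 < L := by exact_mod_cast h2
            exact_mod_cast this
          have := mul_le_mul_of_nonneg_right hL3 hc
          linarith
    nlinarith
  · have h54 : (2 / 9 : ℝ) ≤ Real.log (5 / 4) := by
      have := Real.le_log_one_add_of_nonneg (x := 1 / 4) (by norm_num)
      norm_num at this ⊢
      linarith
    have h258 : Real.log 2 + 4 / 9 ≤ Real.log (25 / 8) := by
      have : (25 / 8 : ℝ) = 2 * ((5 / 4) * (5 / 4)) := by norm_num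
      rw [this, Real.log_mul (by norm_num) (by norm_num), Real.log_mul (by norm_num) (by norm_num)]
      linarith
    have h₁ := hmul (25 / 8) (by norm_num)
    have h₂ : L * ((1 + y) * (Real.log 2 + 4 / 9) + 1 + y - 25 / 8) ≤
        L * ((1 + y) * Real.log (25 / 8) + 1 + y - 25 / 8) := by gcongr
    have hlz := mul_le_mul_of_nonneg_left hlog2.le hz0
    have hLl := mul_le_mul_of_nonneg_left hlog2.le hL0.le
    nlinarith

end Numerics


/-! ### Extra and idle steps, safe queues, and the count for a single queue. -/

section Traces
open Finset
open scoped Classical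

/-- Process the elements of `E` in increasing order of `j` and match each of them to an eligible
element of `K` that is not yet matched, if there is one. The set `S` consists of the elements that
stay unmatched. -/
theorem exists_greedy_matching {α β : Type*} [Nonempty α] (E : Finset α) (K : Finset β) (j : α → ℕ)
    (elig : α → β → Prop) : ∃ S ⊆ E, ∃ K' ⊆ K, ∃ g : β → α,
      (∀ e ∈ K', g e ∈ E ∧ g e ∉ S ∧ elig (g e) e) ∧ Set.InjOn g K' ∧
      E.card = S.card + K'.card ∧ ∀ i ∈ S, ∀ e ∈ K, elig i e → e ∈ K' ∧ j (g e) ≤ j i := by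
  induction E using Finset.induction_on_max_value j with
  | empty => exact ⟨∅, by simp, ∅, by simp, fun _ => Classical.arbitrary α, by simp⟩
  | insert a E ha hmax ih =>
    obtain ⟨S, hS, K', hK, g, hg, hinj, hcard, hmatch⟩ := ih
    by_cases h : ∃ e ∈ K, e ∉ K' ∧ elig a e
    · obtain ⟨e, he, he', hae⟩ := h
      have hup : ∀ e₁ ∈ K', Function.update g e a e₁ = g e₁ := fun e₁ h₁ =>
        Function.update_of_ne (fun h => he' (by rwa [← h])) _ _
      refine ⟨S, hS.trans (subset_insert _ _), insert e K', insert_subset he hK,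
        Function.update g e a, ?_, ?_, ?_, ?_⟩
      · intro e₁ h₁
        rcases mem_insert.1 h₁ with rfl | h₁
        · rw [Function.update_self]
          exact ⟨mem_insert_self _ _, fun h => ha (hS h), hae⟩
        · rw [hup e₁ h₁]
          exact ⟨mem_insert_of_mem (hg e₁ h₁).1, (hg e₁ h₁).2⟩
      · rw [coe_insert, Set.injOn_insert (by simpa using he')]
        refine ⟨fun x hx y hy hxy => hinj hx hy (by rwa [hup x hx, hup y hy] at hxy), ?_⟩
        rintro ⟨y, hy, hya⟩
        rw [hup y hy, Function.update_self] at hya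
        exact ha (hya ▸ (hg y hy).1)
      · rw [card_insert_of_notMem ha, card_insert_of_notMem he', hcard, add_assoc]
      · intro i hi e₁ h₁ hie
        obtain ⟨h₂, h₃⟩ := hmatch i hi e₁ h₁ hie
        rw [hup e₁ h₂]
        exact ⟨mem_insert_of_mem h₂, h₃⟩
    · push Not at h
      refine ⟨insert a S, insert_subset_insert _ hS, K', hK, g, ?_, hinj, ?_, ?_⟩
      · intro e he
        refine ⟨mem_insert_of_mem (hg e he).1, fun h => ?_, (hg e he).2.2⟩
        rcases mem_insert.1 h with h | h
        · exact ha (h ▸ (hg e he).1)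
        · exact (hg e he).2.1 h
      · rw [card_insert_of_notMem ha, card_insert_of_notMem fun h => ha (hS h), hcard]
        omega
      · intro i hi e he hie
        rcases mem_insert.1 hi with rfl | hi
        · have h₁ : e ∈ K' := by
            by_contra h₁
            exact h e he h₁ hie
          exact ⟨h₁, hmax _ (hg e h₁).1⟩
        · exact hmatch i hi e he hie

/-- The queue lengths `l` of Longest Queue Drop and `o` of another algorithm with the same buffer
size `M`, after the arrivals of each time step; both buffers are empty from time `H` on. The
predicate `dr t q` says that Longest Queue Drop drops some packet for port `q` in step `t`. -/
structure Trace (Q : Type) [Fintype Q] (M H : ℕ) where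
  l : ℕ → Q → ℕ
  o : ℕ → Q → ℕ
  dr : ℕ → Q → Prop
  init : ∀ q, ¬ dr 0 q → o 0 q ≤ l 0 q
  decay : ∀ t q, ¬ dr (t + 1) q → l t q ≤ l (t + 1) q + 1
  lead : ∀ t q, ¬ dr (t + 1) q → o (t + 1) q + (l t q - 1) ≤ (o t q - 1) + l (t + 1) q
  full : ∀ t q, dr t q → ∑ p, l t p = M ∧ ∀ p, l t p ≤ l t q + 1
  cap : ∀ t, ∑ q, o t q ≤ M
  fin : ∀ t q, H ≤ t → l t q = 0 ∧ o t q = 0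

namespace Trace
variable {Q : Type} [Fintype Q] {M H : ℕ} (T : Trace Q M H)

/-- No packet for port `q` is dropped after step `s` up to step `e`. -/
def Quiet (s e : ℕ) (q : Q) : Prop := ∀ r, s < r → r ≤ e → ¬ T.dr r q

/-- Only the other algorithm transmits a packet. -/
def Extra (d : ℕ) (q : Q) : Prop := T.l d q = 0 ∧ 0 < T.o d q

/-- Only Longest Queue Drop transmits a packet. -/
def Idle (s : ℕ) (q : Q) : Prop := T.o s q = 0 ∧ 0 < T.l s q

/-- An extra packet is transmitted later on, with no packet being dropped in between. -/
def Pending (s : ℕ) (q : Q) : Prop := ∃ d, s ≤ d ∧ T.Extra d q ∧ T.Quiet s d q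

/-- The queue becomes empty before any further packet is dropped from it, either in some step up to
step `d` or before an extra packet is transmitted. -/
def Safe (d s : ℕ) (q : Q) : Prop :=
  T.Pending s q ∨ ∃ e, s < e ∧ e ≤ d ∧ T.l e q = 0 ∧ T.Quiet s e q

/-- The nonempty safe queues. -/
noncomputable def X (d s : ℕ) : Finset Q := univ.filter fun q => 0 < T.l s q ∧ T.Safe d s q

/-- The nonempty queues that are not safe. -/
noncomputable def A (d s : ℕ) : Finset Q := univ.filter fun q => 0 < T.l s q ∧ ¬ T.Safe d s q

/-- The part of the buffer that is left besides the safe queues and the packets to be transmitted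
from the others. -/
noncomputable def Y (d s : ℕ) : ℝ := M - ∑ q ∈ T.X d s, (T.l s q : ℝ) - (T.A d s).card

/-- The last step in which a packet is dropped from a queue before an extra packet is transmitted
from it. -/
noncomputable def join (i : ℕ × Q) : ℕ := Nat.findGreatest (fun t => T.dr t i.2) i.1

noncomputable def extras : Finset (ℕ × Q) :=
  (range H ×ˢ univ).filter fun i => T.Extra i.1 i.2

noncomputable def idles : Finset (ℕ × Q) :=
  (range H ×ˢ univ).filter fun i => T.Idle i.1 i.2

variable {T}

theorem Quiet.mono {s e s' e' : ℕ} {q : Q} (h : T.Quiet s e q) (hs : s ≤ s') (he : e' ≤ e) :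
    T.Quiet s' e' q := fun r h₁ h₂ => h r (hs.trans_lt h₁) (h₂.trans he)

theorem Quiet.extend {s e : ℕ} {q : Q} (h : T.Quiet (s + 1) e q) (hs : ¬ T.dr (s + 1) q) :
    T.Quiet s e q := fun r h₁ h₂ => by
  rcases (Nat.succ_le_of_lt h₁).eq_or_lt with h₃ | h₃
  · exact h₃ ▸ hs
  · exact h r h₃ h₂

theorem mem_X {d s : ℕ} {q : Q} : q ∈ T.X d s ↔ 0 < T.l s q ∧ T.Safe d s q := by simp [X]

theorem mem_A {d s : ℕ} {q : Q} : q ∈ T.A d s ↔ 0 < T.l s q ∧ ¬ T.Safe d s q := by simp [A]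

theorem mem_extras {i : ℕ × Q} : i ∈ T.extras ↔ T.Extra i.1 i.2 := by
  simp only [extras, mem_filter, mem_product, mem_range, mem_univ, and_true, and_iff_right_iff_imp]
  intro h
  by_contra h'
  have := (T.fin i.1 i.2 (not_lt.1 h')).2
  have := h.2
  omega

theorem mem_idles {i : ℕ × Q} : i ∈ T.idles ↔ T.Idle i.1 i.2 := by
  simp only [idles, mem_filter, mem_product, mem_range, mem_univ, and_true, and_iff_right_iff_imp]
  intro h
  by_contra h'
  have := (T.fin i.1 i.2 (not_lt.1 h')).1
  have := h.2
  omega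

theorem Safe.not_dr {d s : ℕ} {q : Q} (hl : 0 < T.l s q) (h : T.Safe d s q) :
    ¬ T.dr (s + 1) q := by
  rcases h with ⟨e, hse, hex, hq⟩ | ⟨e, hse, _, _, hq⟩
  · refine hq _ (Nat.lt_succ_self s) (Nat.succ_le_of_lt (lt_of_le_of_ne hse ?_))
    rintro rfl
    exact hl.ne' hex.1
  · exact hq _ (Nat.lt_succ_self s) hse

theorem Safe.succ {d s : ℕ} {q : Q} (hl : 0 < T.l s q) (hl' : 0 < T.l (s + 1) q)
    (h : T.Safe d s q) : T.Safe d (s + 1) q := by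
  rcases h with ⟨e, hse, hex, hq⟩ | ⟨e, hse, hed, hle, hq⟩
  · refine Or.inl ⟨e, Nat.succ_le_of_lt (lt_of_le_of_ne hse ?_), hex,
      hq.mono (Nat.le_succ s) le_rfl⟩
    rintro rfl
    exact hl.ne' hex.1
  · refine Or.inr ⟨e, lt_of_le_of_ne (Nat.succ_le_of_lt hse) ?_, hed, hle,
      hq.mono (Nat.le_succ s) le_rfl⟩
    rintro rfl
    exact hl'.ne' hle

theorem Safe.of_succ {d s : ℕ} {q : Q} (h : T.Safe d (s + 1) q) (hs : ¬ T.dr (s + 1) q) :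
    T.Safe d s q := by
  rcases h with ⟨e, hse, hex, hq⟩ | ⟨e, hse, hed, hle, hq⟩
  · exact Or.inl ⟨e, by omega, hex, hq.extend hs⟩
  · exact Or.inr ⟨e, by omega, hed, hle, hq.extend hs⟩

theorem o_le_l {d : ℕ} {q : Q} (h : ∀ r ≤ d, ¬ T.dr r q) : T.o d q ≤ T.l d q := by
  induction d with
  | zero => exact T.init q (h 0 le_rfl)
  | succ d ih =>
    have h₁ := ih fun r hr => h r (hr.trans (Nat.le_succ d))
    have h₂ := T.lead d q (h _ le_rfl)
    omega

/-- Without any drop, LQD would hold at least as many packets for the queue as the other run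
(`o_le_l`), so the default value 0 of `Nat.findGreatest` is never taken without a drop in step 0. -/
theorem Extra.dr_join {i : ℕ × Q} (h : T.Extra i.1 i.2) : T.dr (T.join i) i.2 := by
  have : ∃ r ≤ i.1, T.dr r i.2 := by
    by_contra hne
    push Not at hne
    have h₁ := o_le_l hne
    have := h.1
    have := h.2
    omega
  obtain ⟨r, hr, hdr⟩ := this
  exact Nat.findGreatest_spec (P := fun t => T.dr t i.2) hr hdr

variable (T) in
theorem join_le (i : ℕ × Q) : T.join i ≤ i.1 := Nat.findGreatest_le _

variable (T) in
theorem quiet_join (i : ℕ × Q) : T.Quiet (T.join i) i.1 i.2 := fun _ h₁ h₂ =>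
  Nat.findGreatest_is_greatest h₁ h₂

/-- While no packet is dropped, a queue decreases by at most one packet in each step. -/
theorem Quiet.le_add {s e : ℕ} {q : Q} (h : T.Quiet s e q) (hse : s ≤ e) :
    T.l s q ≤ T.l e q + (e - s) := by
  induction e, hse using Nat.le_induction with
  | base => omega
  | succ e hse ih =>
    have h₁ := ih (h.mono le_rfl (Nat.le_succ e))
    have h₂ := T.decay e q (h _ (by omega) le_rfl)
    omega

/-- By `lead`, the excess of `o` over `l` falls by one at each extra and can grow only in idle
steps. Idle steps cannot occur here, because the extra in step `d` forces a positive excess all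
along. -/
theorem Extra.card_add_le {s d : ℕ} {q : Q} (hd : T.Extra d q) (hq : T.Quiet s d q) (hsd : s ≤ d) :
    ((Icc s d).filter fun r => T.Extra r q).card + T.l s q ≤ T.o s q := by
  induction hsd using Nat.decreasingInduction with
  | self =>
    rw [Icc_self, filter_singleton, if_pos hd, card_singleton, hd.1]
    exact hd.2
  | of_succ s hs ih =>
    have h₁ := ih (hq.mono (Nat.le_succ s) le_rfl)
    have h₂ := T.lead s q (hq _ (Nat.lt_succ_self s) hs)
    have h₃ : 0 < ((Icc (s + 1) d).filter fun r => T.Extra r q).card :=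
      card_pos.2 ⟨d, mem_filter.2 ⟨mem_Icc.2 ⟨hs, le_rfl⟩, hd⟩⟩
    have h₄ : Icc s d = insert s (Icc (s + 1) d) := by
      ext; simp only [mem_insert, mem_Icc]; omega
    rw [h₄, filter_insert]
    split_ifs with h
    · rw [card_insert_of_notMem (by simp)]
      have := h.1
      omega
    · have : 0 < T.l s q ∨ T.o s q = 0 := by
        unfold Extra at h; omega
      omega

/-- The deficit of `o` against `l` is gone when the queue is empty, and each idle step repairs at
most one unit of it. -/
theorem Quiet.le_add_idle {s e : ℕ} {q : Q} (hq : T.Quiet s e q) (he : T.l e q = 0) (hse : s ≤ e) :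
    T.l s q ≤ T.o s q + ((Ico s e).filter fun r => T.Idle r q).card := by
  induction hse using Nat.decreasingInduction with
  | self => omega
  | of_succ s hs ih =>
    have h₁ := ih (hq.mono (Nat.le_succ s) le_rfl)
    have h₂ := T.lead s q (hq _ (Nat.lt_succ_self s) hs)
    have h₄ : Ico s e = insert s (Ico (s + 1) e) := by
      ext; simp only [mem_insert, mem_Ico]; omega
    rw [h₄, filter_insert]
    split_ifs with h
    · rw [card_insert_of_notMem (by simp)]
      omega
    · have : T.l s q = 0 ∨ 0 < T.o s q := by
        unfold Idle at h; omega
      omega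

variable (T) in
/-- The packets of the other algorithm for port `q` in step `s`, together with the later idle steps,
cover the coming extra packets and what Longest Queue Drop has to reserve for port `q`. -/
theorem alive_add_le (d s : ℕ) (hsd : s ≤ d) (q : Q) (E : Finset ℕ)
    (hE : ∀ e ∈ E, s ≤ e ∧ T.Extra e q ∧ T.Quiet s e q) :
    E.card + (if q ∈ T.X d s then T.l s q else 0) + (if q ∈ T.A d s then 1 else 0) ≤
      T.o s q + ((Icc s d).filter fun r => T.Idle r q).card := by
  have hXA : q ∈ T.X d s → q ∉ T.A d s := fun h h' => (mem_A.1 h').2 (mem_X.1 h).2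
  by_cases hp : T.Pending s q
  · have hA : q ∉ T.A d s := fun h => (mem_A.1 h).2 (Or.inl hp)
    rw [if_neg hA]
    have hX : (if q ∈ T.X d s then T.l s q else 0) ≤ T.l s q := by split_ifs <;> omega
    have key : ∃ e, s ≤ e ∧ T.Extra e q ∧ T.Quiet s e q ∧ ∀ e' ∈ E, e' ≤ e := by
      rcases E.eq_empty_or_nonempty with rfl | hne
      · obtain ⟨e, h₁, h₂, h₃⟩ := hp
        exact ⟨e, h₁, h₂, h₃, by simp⟩
      · obtain ⟨h₁, h₂, h₃⟩ := hE _ (E.max'_mem hne)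
        exact ⟨_, h₁, h₂, h₃, fun e' he' => E.le_max' _ he'⟩
    obtain ⟨e, h₁, h₂, h₃, h₄⟩ := key
    have h₅ := h₂.card_add_le h₃ h₁
    have h₆ : E.card ≤ ((Icc s e).filter fun r => T.Extra r q).card :=
      card_le_card fun e' he' => mem_filter.2
        ⟨mem_Icc.2 ⟨(hE e' he').1, h₄ e' he'⟩, (hE e' he').2.1⟩
    omega
  · have hE0 : E = ∅ := eq_empty_of_forall_notMem fun e he => hp ⟨e, hE e he⟩
    rw [hE0, card_empty]
    by_cases hX : q ∈ T.X d s
    · rw [if_pos hX, if_neg (hXA hX)]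
      rcases (mem_X.1 hX).2 with h | ⟨e, h₁, h₂, h₃, h₄⟩
      · exact absurd h hp
      · have h₅ := h₄.le_add_idle h₃ h₁.le
        have h₆ : ((Ico s e).filter fun r => T.Idle r q).card ≤
            ((Icc s d).filter fun r => T.Idle r q).card :=
          card_le_card (filter_subset_filter _ fun r hr => by
            rw [mem_Ico] at hr
            exact mem_Icc.2 ⟨hr.1, by omega⟩)
        omega
    · rw [if_neg hX]
      split_ifs with hA
      · by_cases ho : T.o s q = 0
        · have : 0 < ((Icc s d).filter fun r => T.Idle r q).card :=
            card_pos.2 ⟨s, mem_filter.2 ⟨mem_Icc.2 ⟨le_rfl, hsd⟩, ho, (mem_A.1 hA).1⟩⟩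
          omega
        · omega
      · omega

end Trace
end Traces

/-! ### The level Y bounds the alive extras and rises only against payment. -/

section Levels
open Finset
open scoped Classical

theorem card_filter_product_univ {Q : Type} [Fintype Q] (I : Finset ℕ) (P : ℕ → Q → Prop) :
    ((I ×ˢ (univ : Finset Q)).filter fun i => P i.1 i.2).card =
      ∑ q, (I.filter fun t => P t q).card := by
  rw [card_filter, sum_product_right]
  exact sum_congr rfl fun q _ => (card_filter _ _).symm

theorem log_sub_log_le {n n' g Z Y : ℝ} (hn : 0 < n) (hn' : 0 < n') (hZ : 0 < Z) (hY : 0 < Y)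
    (h : n * Y ^ 2 ≤ n' * Z * (Y + g)) : Real.log (Y / n') - Real.log (Z / n) ≤ g / Y := by
  have h₁ : 0 < Y / n' := by positivity
  have h₂ : 0 < Z / n := by positivity
  rw [← Real.log_div h₁.ne' h₂.ne']
  refine (Real.log_le_sub_one_of_pos (by positivity)).trans ?_
  have : Y / n' / (Z / n) ≤ 1 + g / Y := by
    rw [div_div_div_eq, div_le_iff₀ (by positivity), ← sub_nonneg]
    have : (1 + g / Y) * (n' * Z) - Y * n = (n' * Z * (Y + g) - n * Y ^ 2) / Y := by
      field_simp
    rw [this]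
    exact div_nonneg (sub_nonneg.2 h) hY.le
  linarith

theorem level_inequality {n n' g Z Y L : ℝ} (hn' : 0 < n') (hg : 0 ≤ g) (hY : 0 < Y)
    (hL : 1 ≤ L) (hYL : Y ≤ L * n') (hZ : Y + g * L + n' - n ≤ Z) (hnn : n ≤ n' + g) :
    n * Y ^ 2 ≤ n' * Z * (Y + g) := by
  have h₁ : n' * (Y + g * L + n' - n) * (Y + g) ≤ n' * Z * (Y + g) := by gcongr
  have h₂ : 0 ≤ (n' + g - n) * (n' * (Y + g) + Y ^ 2) :=
    mul_nonneg (sub_nonneg.2 hnn) (by positivity)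
  have h₃ : 0 ≤ g * Y * (L * n' - Y) := mul_nonneg (by positivity) (sub_nonneg.2 hYL)
  have h₄ : 0 ≤ g * g * n' * (L - 1) := mul_nonneg (by positivity) (sub_nonneg.2 hL)
  -- The difference of the two sides in `h₁`'s lower bound equals the sum of the three products in
  -- `h₂`, `h₃` and `h₄`.
  nlinarith

namespace Trace
variable {Q : Type} [Fintype Q] {M H : ℕ} (T : Trace Q M H)

/-- An extra packet may be matched to an idle step between the last preceding drop from its queue
and its own transmission. -/
def Elig (i e : ℕ × Q) : Prop := T.join i ≤ e.1 ∧ e.1 ≤ i.1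

variable {T}

/-- As `i` stayed unmatched, every idle step from `s` to `i.1` is matched, and by the greedy order
its partner has a join time at most that of `i`. These partners are thus alive at `s` and lie
outside `S`. Summing `alive_add_le` over the queues counts all alive extras, and the idle steps
cancel against their partners. -/
theorem card_alive_le {S K : Finset (ℕ × Q)} {g : ℕ × Q → ℕ × Q} (hS : S ⊆ T.extras)
    (hg : ∀ e ∈ K, g e ∈ T.extras ∧ g e ∉ S ∧ T.Elig (g e) e) (hinj : Set.InjOn g K)
    (hmatch : ∀ i ∈ S, ∀ e ∈ T.idles, T.Elig i e → e ∈ K ∧ T.join (g e) ≤ T.join i)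
    {i : ℕ × Q} (hi : i ∈ S) {s : ℕ} (hs : T.join i ≤ s) (hsd : s ≤ i.1) :
    ((S.filter fun j => T.join j ≤ s ∧ s ≤ j.1).card : ℝ) ≤ T.Y i.1 s := by
  set al : Finset (ℕ × Q) :=
    (range H ×ˢ univ).filter fun j => T.Extra j.1 j.2 ∧ T.join (j.1, j.2) ≤ s ∧ s ≤ j.1 with hal
  set id : Finset (ℕ × Q) := (Icc s i.1 ×ˢ univ).filter fun j => T.Idle j.1 j.2 with hid
  have mem_al : ∀ j, j ∈ al ↔ j ∈ T.extras ∧ T.join j ≤ s ∧ s ≤ j.1 := fun j => by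
    simp only [hal, extras, mem_filter, and_assoc]
  have mem_id : ∀ j, j ∈ id → j ∈ T.idles ∧ s ≤ j.1 ∧ j.1 ≤ i.1 := fun j hj => by
    simp only [hid, mem_filter, mem_product, mem_Icc, mem_univ, and_true] at hj
    exact ⟨mem_idles.2 hj.2, hj.1⟩
  have hidK : ∀ e ∈ id, e ∈ K ∧ T.join (g e) ≤ T.join i := fun e he =>
    hmatch i hi e (mem_id e he).1 ⟨hs.trans (mem_id e he).2.1, (mem_id e he).2.2⟩
  have h₁ : (S.filter fun j => T.join j ≤ s ∧ s ≤ j.1).card + id.card ≤ al.card := by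
    rw [← card_image_of_injOn (hinj.mono fun e he => (hidK e he).1), ← card_union_of_disjoint]
    · refine card_le_card (union_subset (fun j hj => ?_) fun j hj => ?_)
      · rw [mem_filter] at hj
        exact (mem_al j).2 ⟨hS hj.1, hj.2⟩
      · obtain ⟨e, he, rfl⟩ := mem_image.1 hj
        obtain ⟨h₁, h₂⟩ := hidK e he
        obtain ⟨h₃, _, h₄⟩ := hg e h₁
        exact (mem_al _).2 ⟨h₃, h₂.trans hs, (mem_id e he).2.1.trans h₄.2⟩
    · rw [disjoint_left]
      intro j hj hj'
      obtain ⟨e, he, rfl⟩ := mem_image.1 hj'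
      exact (hg e (hidK e he).1).2.1 (mem_filter.1 hj).1
  have h₂ : al.card = ∑ q, ((range H).filter fun t =>
      T.Extra t q ∧ T.join (t, q) ≤ s ∧ s ≤ t).card := by
    convert card_filter_product_univ (range H) fun t q => T.Extra t q ∧ T.join (t, q) ≤ s ∧ s ≤ t
  have h₃ : id.card = ∑ q, ((Icc s i.1).filter fun t => T.Idle t q).card :=
    card_filter_product_univ _ _
  have h₄ := sum_le_sum fun q (_ : q ∈ (univ : Finset Q)) => T.alive_add_le i.1 s hsd q
    ((range H).filter fun t => T.Extra t q ∧ T.join (t, q) ≤ s ∧ s ≤ t) fun e he => by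
      simp only [mem_filter] at he
      exact ⟨he.2.2.2, he.2.1, (T.quiet_join (e, q)).mono he.2.2.1 le_rfl⟩
  simp only [sum_add_distrib, ← h₂, ← h₃, sum_ite_mem, univ_inter, sum_const, smul_eq_mul,
    mul_one] at h₄
  have h₅ := T.cap s
  have h₆ : (S.filter fun j => T.join j ≤ s ∧ s ≤ j.1).card + ∑ q ∈ T.X i.1 s, T.l s q +
      (T.A i.1 s).card ≤ M := by omega
  have h₇ : ((S.filter fun j => T.join j ≤ s ∧ s ≤ j.1).card : ℝ) +
      ∑ q ∈ T.X i.1 s, (T.l s q : ℝ) + (T.A i.1 s).card ≤ M := by exact_mod_cast h₆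
  unfold Y
  linarith

theorem disjoint_X_A (d s : ℕ) : Disjoint (T.X d s) (T.A d s) :=
  disjoint_left.2 fun _ h h' => (mem_A.1 h').2 (mem_X.1 h).2

variable (T) in
theorem sum_X_add_sum_A (d s : ℕ) :
    ∑ q ∈ T.X d s, T.l s q + ∑ q ∈ T.A d s, T.l s q = ∑ q, T.l s q := by
  rw [← sum_union (disjoint_X_A d s)]
  refine sum_subset (subset_univ _) fun q _ hq => ?_
  by_contra h
  have h := Nat.pos_of_ne_zero h
  apply hq
  rw [mem_union, mem_X, mem_A]
  tauto

/-- The level is at most `L` per unsafe queue if the buffer is full and all queues have at most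
`L + 1` packets. -/
theorem Y_le_of_full {d s L : ℕ} (hM : ∑ q, T.l s q = M) (hL : ∀ q, T.l s q ≤ L + 1) :
    T.Y d s ≤ L * (T.A d s).card := by
  have h₁ := T.sum_X_add_sum_A d s
  have h₂ : ∑ q ∈ T.A d s, T.l s q ≤ (T.A d s).card * (L + 1) := by
    rw [← smul_eq_mul]
    exact sum_le_card_nsmul _ _ _ fun q _ => hL q
  rw [hM] at h₁
  have h₃ : ∑ q ∈ T.X d s, (T.l s q : ℝ) + ∑ q ∈ T.A d s, (T.l s q : ℝ) = M := by
    exact_mod_cast h₁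
  have h₄ : ∑ q ∈ T.A d s, (T.l s q : ℝ) ≤ (T.A d s).card * (L + 1) := by exact_mod_cast h₂
  unfold Y
  linarith

/-- A nonempty safe queue suffers no drop in the next step and remains safe until it is empty. -/
theorem sum_X_le (d s : ℕ) : ∑ q ∈ T.X d s, T.l s q ≤
    ∑ q ∈ T.X d (s + 1) ∩ T.X d s, T.l (s + 1) q + (T.X d s).card := by
  have h₁ : ∑ q ∈ T.X d (s + 1) ∩ T.X d s, T.l (s + 1) q = ∑ q ∈ T.X d s, T.l (s + 1) q := by
    refine sum_subset inter_subset_right fun q hq hq' => ?_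
    by_contra h
    have h := Nat.pos_of_ne_zero h
    rw [mem_X] at hq
    exact hq' (mem_inter.2 ⟨mem_X.2 ⟨h, hq.2.succ hq.1 h⟩, mem_X.2 hq⟩)
  rw [h₁, card_eq_sum_ones, ← sum_add_distrib]
  refine sum_le_sum fun q hq => ?_
  rw [mem_X] at hq
  exact T.decay s q (hq.2.not_dr hq.1)

theorem A_dr {d s : ℕ} {q : Q} (hA : q ∈ T.A d s) (hX : q ∈ T.X d (s + 1)) : T.dr (s + 1) q := by
  by_contra h
  exact (mem_A.1 hA).2 ((mem_X.1 hX).2.of_succ h)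

/-- Emptying without a drop by step `d` would have made the queue safe already; a drop that leaves
it empty would force the level to be nonpositive by `Y_le_of_full`. -/
theorem mem_A_succ {d s : ℕ} (hsd : s < d) (hY : 0 < T.Y d (s + 1)) {q : Q} (hA : q ∈ T.A d s)
    (hX : q ∉ T.X d (s + 1)) : q ∈ T.A d (s + 1) := by
  by_cases hl : 0 < T.l (s + 1) q
  · exact mem_A.2 ⟨hl, fun h => hX (mem_X.2 ⟨hl, h⟩)⟩
  · have hl : T.l (s + 1) q = 0 := by omega
    exfalso
    by_cases hdr : T.dr (s + 1) q
    · obtain ⟨h₁, h₂⟩ := T.full _ _ hdr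
      rw [hl] at h₂
      have := Y_le_of_full (d := d) h₁ h₂
      simp only [Nat.cast_zero, zero_mul] at this
      linarith
    · refine (mem_A.1 hA).2 (Or.inr ⟨s + 1, Nat.lt_succ_self s, hsd, hl, fun r h₁ h₂ => ?_⟩)
      obtain rfl : r = s + 1 := by omega
      exact hdr

/-- Transmissions from safe queues raise Y by at most |X|, which costs |X|/Y in the logarithm. The
set `G` of queues turning safe lowers |A|, but each of them suffers a drop; then the buffer is full
and the level per unsafe queue is at most the shortest length in `G`, so the lengths absorbed into X
keep the rise below |G|/Y. -/
theorem level_step {d s : ℕ} (hsd : s < d) (hY : 0 < T.Y d s) (hY' : 0 < T.Y d (s + 1))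
    (hn : 0 < (T.A d s).card) : 0 < (T.A d (s + 1)).card ∧
      Real.log (T.Y d (s + 1) / (T.A d (s + 1)).card) - Real.log (T.Y d s / (T.A d s).card) ≤
        (T.X d s).card / T.Y d s +
          ((T.X d (s + 1)).filter fun q => T.dr (s + 1) q).card / T.Y d (s + 1) := by
  set G := T.A d s ∩ T.X d (s + 1) with hG
  have hnn : (T.A d s).card ≤ (T.A d (s + 1)).card + G.card := by
    rw [← card_sdiff_add_card_inter (T.A d s) (T.X d (s + 1))]
    refine Nat.add_le_add_right (card_le_card fun q hq => ?_) _
    rw [mem_sdiff] at hq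
    exact mem_A_succ hsd hY' hq.1 hq.2
  have hGdr : G ⊆ (T.X d (s + 1)).filter fun q => T.dr (s + 1) q := fun q hq => by
    rw [hG, mem_inter] at hq
    exact mem_filter.2 ⟨hq.2, A_dr hq.1 hq.2⟩
  have hGX : G ⊆ T.X d (s + 1) \ T.X d s := fun q hq => by
    rw [hG, mem_inter] at hq
    exact mem_sdiff.2 ⟨hq.2, disjoint_right.1 (disjoint_X_A d s) hq.1⟩
  have hsum : ∑ q ∈ G, (T.l (s + 1) q : ℝ) ≤ ∑ q ∈ T.X d (s + 1) \ T.X d s, (T.l (s + 1) q : ℝ) :=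
    sum_le_sum_of_subset_of_nonneg hGX fun _ _ _ => Nat.cast_nonneg _
  have hZ : T.Y d (s + 1) + ∑ q ∈ G, (T.l (s + 1) q : ℝ) + (T.A d (s + 1)).card - (T.A d s).card ≤
      T.Y d s + (T.X d s).card := by
    have h₁ : ∑ q ∈ T.X d s, (T.l s q : ℝ) ≤
        ∑ q ∈ T.X d (s + 1) ∩ T.X d s, (T.l (s + 1) q : ℝ) + (T.X d s).card := by
      exact_mod_cast sum_X_le (T := T) d s
    have h₂ := sum_inter_add_sum_sdiff (T.X d (s + 1)) (T.X d s) fun q => (T.l (s + 1) q : ℝ)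
    unfold Y
    linarith
  set n : ℝ := ((T.A d s).card : ℝ) with hn_def
  set n' : ℝ := ((T.A d (s + 1)).card : ℝ) with hn'_def
  set Z : ℝ := T.Y d s + ((T.X d s).card : ℝ) with hZ_def
  have hn0 : 0 < n := Nat.cast_pos.2 hn
  have hZ0 : 0 < Z := by positivity
  have hnn' : n ≤ n' + G.card := by rw [hn_def, hn'_def]; exact_mod_cast hnn
  have hZY : Real.log (Z / n) - Real.log (T.Y d s / n) ≤ (T.X d s).card / T.Y d s := by
    rw [Real.log_div hZ0.ne' hn0.ne', Real.log_div hY.ne' hn0.ne', sub_sub_sub_cancel_right,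
      ← Real.log_div hZ0.ne' hY.ne']
    refine (Real.log_le_sub_one_of_pos (by positivity)).trans (le_of_eq ?_)
    rw [hZ_def]
    field_simp
    ring
  have key : 0 < n' ∧ n * T.Y d (s + 1) ^ 2 ≤ n' * Z * (T.Y d (s + 1) + G.card) := by
    rcases G.eq_empty_or_nonempty with h | h
    · rw [h] at hZ hnn' ⊢
      simp only [sum_empty, card_empty, Nat.cast_zero, add_zero] at hZ hnn' ⊢
      have hn'0 : 0 < n' := hn0.trans_le hnn'
      refine ⟨hn'0, ?_⟩
      have : T.Y d (s + 1) ≤ Z := by linarith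
      calc n * T.Y d (s + 1) ^ 2 = n * (T.Y d (s + 1) * T.Y d (s + 1)) := by ring
        _ ≤ n' * (Z * T.Y d (s + 1)) := by gcongr
        _ = _ := by ring
    · obtain ⟨r, hr, hmin⟩ := exists_min_image G (T.l (s + 1)) h
      have hr' := mem_inter.1 hr
      obtain ⟨h₁, h₂⟩ := T.full _ _ (A_dr hr'.1 hr'.2)
      have h₃ := Y_le_of_full (d := d) h₁ h₂
      have hL : (1 : ℝ) ≤ T.l (s + 1) r := by exact_mod_cast (mem_X.1 hr'.2).1
      have hn'0 : 0 < n' := by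
        by_contra hneg
        have : n' = 0 := le_antisymm (not_lt.1 hneg) (Nat.cast_nonneg _)
        rw [← hn'_def, this, mul_zero] at h₃
        linarith
      refine ⟨hn'0, level_inequality hn'0 (Nat.cast_nonneg _) hY' hL h₃ ?_ hnn'⟩
      have h₄ : (G.card : ℝ) * T.l (s + 1) r ≤ ∑ q ∈ G, (T.l (s + 1) q : ℝ) := by
        rw [← nsmul_eq_mul]
        exact card_nsmul_le_sum _ _ _ fun q hq => by exact_mod_cast hmin q hq
      linarith
  refine ⟨Nat.cast_pos.1 key.1, ?_⟩
  have h₁ := log_sub_log_le hn0 key.1 hZ0 hY' key.2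
  have h₂ : (G.card : ℝ) / T.Y d (s + 1) ≤
      ((T.X d (s + 1)).filter fun q => T.dr (s + 1) q).card / T.Y d (s + 1) := by
    have : (G.card : ℝ) ≤ ((T.X d (s + 1)).filter fun q => T.dr (s + 1) q).card := by
      exact_mod_cast card_le_card hGdr
    gcongr
  linarith

end Trace
end Levels

/-! ### Distributing LQD's packets among the unmatched extras. -/

section Payments
open Finset
open scoped Classical

namespace Trace
variable {Q : Type} [Fintype Q] {M H : ℕ} (T : Trace Q M H)

/-- The nonempty queues of Longest Queue Drop. -/
noncomputable def sending (s : ℕ) : Finset Q := univ.filter fun q => 0 < T.l s q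

/-- The share of a transmitted packet that is available for an extra packet transmitted in
step `d`. -/
noncomputable def share (d s : ℕ) (q : Q) : ℝ :=
  if T.Safe d s q ∧ ¬ T.dr s q then 1 / 2 else 1

variable {T}

theorem share_le_one (d s : ℕ) (q : Q) : T.share d s q ≤ 1 := by
  unfold share; split_ifs <;> norm_num

variable (T) in
theorem sum_share (d s : ℕ) : ∑ q ∈ T.sending s, T.share d s q =
    (T.A d s).card +
      1 / 2 * ((T.X d s).card + ((T.X d s).filter fun q => T.dr s q).card) := by
  have h₁ : T.sending s = T.X d s ∪ T.A d s := by
    ext q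
    simp only [sending, mem_filter, mem_univ, true_and, mem_union, mem_X, mem_A]
    tauto
  have h₂ : ∀ q ∈ T.A d s, T.share d s q = 1 := fun q hq =>
    if_neg fun h => (mem_A.1 hq).2 h.1
  have h₃ : ∀ q ∈ T.X d s, T.share d s q = 1 / 2 + 1 / 2 * if T.dr s q then 1 else 0 :=
    fun q hq => by
      have := (mem_X.1 hq).2
      unfold share
      by_cases h : T.dr s q
      · simp [h]; norm_num
      · simp [h, this]
  rw [h₁, sum_union (disjoint_X_A d s), sum_congr rfl h₂, sum_congr rfl h₃, sum_add_distrib,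
    ← mul_sum, sum_const, sum_const, nsmul_eq_mul, nsmul_eq_mul, card_filter]
  push_cast
  ring

theorem Extra.level_join {i : ℕ × Q} (hi : T.Extra i.1 i.2) (hY : 1 ≤ T.Y i.1 (T.join i)) :
    0 < T.l (T.join i) i.2 ∧ 0 < (T.A i.1 (T.join i)).card ∧
      T.Y i.1 (T.join i) ≤ T.l (T.join i) i.2 * (T.A i.1 (T.join i)).card := by
  obtain ⟨h₁, h₂⟩ := T.full _ _ hi.dr_join
  have h₃ := Y_le_of_full (d := i.1) h₁ h₂
  refine ⟨Nat.pos_of_ne_zero fun h => ?_, Nat.pos_of_ne_zero fun h => ?_, h₃⟩ <;>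
  · rw [h] at h₃
    simp only [Nat.cast_zero, zero_mul, mul_zero] at h₃
    linarith

theorem Extra.join_add_le {i : ℕ × Q} (hi : T.Extra i.1 i.2) :
    T.join i + T.l (T.join i) i.2 ≤ i.1 := by
  have h₁ := (T.quiet_join i).le_add (T.join_le i)
  have h₂ := hi.1
  have := T.join_le i
  omega

theorem Extra.collected {i : ℕ × Q} (hi : T.Extra i.1 i.2)
    (hY : ∀ s, T.join i ≤ s → s ≤ i.1 → 1 ≤ T.Y i.1 s) :
    1 / (T.l (T.join i) i.2 : ℝ) + 1 / 2 +
        1 / 2 * Real.log (2 * ((i.1 : ℝ) - T.join i) / T.l (T.join i) i.2) ≤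
      ∑ s ∈ Icc (T.join i) i.1, ∑ q ∈ T.sending s, T.share i.1 s q / T.Y i.1 s := by
  obtain ⟨hL, hn, hYL⟩ := hi.level_join (hY _ le_rfl (T.join_le i))
  have hjoin := hi.join_add_le
  set t := T.join i with ht
  set d := i.1 with hd
  have htd : t < d := by omega
  have hY0 : ∀ s, t ≤ s → s ≤ d → 0 < T.Y d s := fun s h₁ h₂ => by linarith [hY s h₁ h₂]
  have hA : ∀ s, t ≤ s → s ≤ d → 0 < (T.A d s).card := by
    intro s hs
    induction s, hs using Nat.le_induction with
    | base => exact fun _ => hn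
    | succ s hs ih =>
      exact fun h => (level_step h (hY0 s hs (by omega)) (hY0 _ (by omega) h) (ih (by omega))).1
  have hA' : ∀ s, t ≤ s → s ≤ d → (0 : ℝ) < (T.A d s).card := fun s h₁ h₂ =>
    Nat.cast_pos.2 (hA s h₁ h₂)
  have h₁ := collected_ge (y := fun s => T.Y d s / (T.A d s).card)
    (w := fun s => (T.X d s).card / T.Y d s +
          ((T.X d (s + 1)).filter fun q => T.dr (s + 1) q).card / T.Y d (s + 1))
    htd (Nat.cast_pos.2 hL)
    (fun s h₁ h₂ => div_pos (hY0 s h₁ h₂) (hA' s h₁ h₂))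
    ((div_le_iff₀ (Nat.cast_pos.2 hn)).2 hYL)
    (fun s h₁ h₂ => add_nonneg (div_nonneg (Nat.cast_nonneg _) (hY0 s h₁ h₂.le).le)
      (div_nonneg (Nat.cast_nonneg _) (hY0 (s + 1) (by omega) h₂).le))
    (fun s h₁ h₂ =>
      (level_step h₂ (hY0 s h₁ h₂.le) (hY0 (s + 1) (by omega) h₂) (hA s h₁ h₂.le)).2)
  refine h₁.trans ?_
  have h₂ : ∑ s ∈ Ico t d, ((T.X d s).card : ℝ) / T.Y d s ≤
      ∑ s ∈ Icc t d, ((T.X d s).card : ℝ) / T.Y d s :=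
    sum_le_sum_of_subset_of_nonneg Ico_subset_Icc_self fun s hs _ =>
      div_nonneg (Nat.cast_nonneg _) (hY0 s (mem_Icc.1 hs).1 (mem_Icc.1 hs).2).le
  -- The drop term belongs to the following step, so the index shifts by one and still ends at `d`.
  have h₃ : ∑ s ∈ Ico t d,
        (((T.X d (s + 1)).filter fun q => T.dr (s + 1) q).card : ℝ) / T.Y d (s + 1) ≤
      ∑ s ∈ Icc t d, (((T.X d s).filter fun q => T.dr s q).card : ℝ) / T.Y d s := by
    rw [sum_Ico_add' (fun s => (((T.X d s).filter fun q => T.dr s q).card : ℝ) / T.Y d s) t d 1]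
    refine sum_le_sum_of_subset_of_nonneg (fun s hs => ?_) fun s hs _ =>
      div_nonneg (Nat.cast_nonneg _) (hY0 s (mem_Icc.1 hs).1 (mem_Icc.1 hs).2).le
    rw [mem_Ico] at hs
    exact mem_Icc.2 ⟨by omega, by omega⟩
  have h₄ : ∑ s ∈ Icc t d, ∑ q ∈ T.sending s, T.share d s q / T.Y d s =
      ∑ s ∈ Icc t d, 1 / (T.Y d s / (T.A d s).card) +
        1 / 2 * (∑ s ∈ Icc t d, ((T.X d s).card : ℝ) / T.Y d s +
          ∑ s ∈ Icc t d, (((T.X d s).filter fun q => T.dr s q).card : ℝ) / T.Y d s) := by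
    rw [← sum_add_distrib, mul_sum, ← sum_add_distrib]
    refine sum_congr rfl fun s _ => ?_
    rw [← sum_div, sum_share, one_div_div]
    ring
  rw [h₄, sum_add_distrib]
  linarith

/-- The periods from the last drop from a queue until the first extra packet from it. -/
noncomputable def eras (T : Trace Q M H) (S : Finset (ℕ × Q)) : Finset (ℕ × Q) :=
  S.image fun i => (T.join i, i.2)

/-- No packet is overspent: the alive extras number at most each of the levels that divide the
shares. In an era of `q` the queue is pending and free of drops, so all shares are 1/2, and the
remaining half serves the era, which is unique because no drop occurs inside it. -/
theorem share_sum_le {S : Finset (ℕ × Q)} (hS : S ⊆ T.extras) {s : ℕ}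
    (hY : ∀ i ∈ S, T.join i ≤ s → s ≤ i.1 →
      ((S.filter fun j => T.join j ≤ s ∧ s ≤ j.1).card : ℝ) ≤ T.Y i.1 s) (q : Q) :
    ∑ i ∈ S.filter (fun j => T.join j ≤ s ∧ s ≤ j.1), T.share i.1 s q / T.Y i.1 s +
      1 / 2 * (((T.eras S).filter fun r => r.1 < s ∧ s < r.1 + T.l r.1 r.2).filter
        fun r => r.2 = q).card ≤ 1 := by
  set F := S.filter fun j => T.join j ≤ s ∧ s ≤ j.1 with hF
  set E := ((T.eras S).filter fun r => r.1 < s ∧ s < r.1 + T.l r.1 r.2).filter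
    fun r => r.2 = q with hE
  have hsum : ∀ c : ℝ, 0 ≤ c → (∀ i ∈ F, T.share i.1 s q ≤ c) →
      ∑ i ∈ F, T.share i.1 s q / T.Y i.1 s ≤ c := fun c hc h => by
    rcases F.eq_empty_or_nonempty with hF0 | hF0
    · rw [hF0, sum_empty]; exact hc
    · have hF1 : (0 : ℝ) < F.card := Nat.cast_pos.2 (card_pos.2 hF0)
      calc ∑ i ∈ F, T.share i.1 s q / T.Y i.1 s ≤ ∑ i ∈ F, c / F.card :=
            sum_le_sum fun i hi => by
              have h₁ := h i hi
              rw [hF, mem_filter] at hi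
              have h₂ := hY i hi.1 hi.2.1 hi.2.2
              gcongr
        _ = c := by rw [sum_const, nsmul_eq_mul]; field_simp
  have mem_E : ∀ r ∈ E, r.2 = q ∧ T.dr r.1 q ∧ r.1 < s ∧
      ∃ e, s < e ∧ T.Extra e q ∧ T.Quiet r.1 e q := fun r hr => by
    simp only [hE, eras, mem_filter, mem_image] at hr
    obtain ⟨⟨⟨i, hi, rfl⟩, h₁, h₂⟩, rfl⟩ := hr
    have hx := mem_extras.1 (hS hi)
    exact ⟨rfl, hx.dr_join, h₁, i.1, h₂.trans_le hx.join_add_le, hx, T.quiet_join i⟩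
  rcases E.eq_empty_or_nonempty with h | ⟨r, hr⟩
  · rw [h, card_empty]
    have := hsum 1 zero_le_one fun i _ => share_le_one _ _ _
    simpa using this
  · have hcard : E.card ≤ 1 := by
      have key : ∀ a ∈ E, ∀ b ∈ E, ¬ a.1 < b.1 := fun a ha b hb hab => by
        obtain ⟨_, _, _, e, h₁, _, h₂⟩ := mem_E a ha
        obtain ⟨_, h₃, h₄, _⟩ := mem_E b hb
        exact h₂ b.1 hab (h₄.le.trans h₁.le) h₃
      refine card_le_one.2 fun a ha b hb => Prod.ext ?_ ?_
      · exact le_antisymm (not_lt.1 (key b hb a ha)) (not_lt.1 (key a ha b hb))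
      · rw [(mem_E a ha).1, (mem_E b hb).1]
    obtain ⟨_, _, h₁, e, h₂, h₃, h₄⟩ := mem_E r hr
    have hhalf := hsum (1 / 2) (by norm_num) fun i _ => by
      rw [share, if_pos]
      exact ⟨Or.inl ⟨e, h₂.le, h₃, h₄.mono h₁.le le_rfl⟩, h₄ s h₁ h₂.le⟩
    have : (E.card : ℝ) ≤ 1 := by exact_mod_cast hcard
    linarith

theorem payments_le {S : Finset (ℕ × Q)} (hS : S ⊆ T.extras)
    (hY : ∀ s, ∀ i ∈ S, T.join i ≤ s → s ≤ i.1 →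
      ((S.filter fun j => T.join j ≤ s ∧ s ≤ j.1).card : ℝ) ≤ T.Y i.1 s) :
    ∑ i ∈ S, ∑ s ∈ Icc (T.join i) i.1, ∑ q ∈ T.sending s, T.share i.1 s q / T.Y i.1 s +
      1 / 2 * ∑ r ∈ T.eras S, ((T.l r.1 r.2 : ℝ) - 1) ≤
      ∑ s ∈ range H, ((T.sending s).card : ℝ) := by
  have hH : ∀ i ∈ S, i.1 < H := fun i hi => by
    have := hS hi
    simp only [extras, mem_filter, mem_product, mem_range] at this
    exact this.1.1
  have h₁ : ∑ i ∈ S, ∑ s ∈ Icc (T.join i) i.1, ∑ q ∈ T.sending s, T.share i.1 s q / T.Y i.1 s =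
      ∑ s ∈ range H, ∑ q ∈ T.sending s,
        ∑ i ∈ S.filter (fun j => T.join j ≤ s ∧ s ≤ j.1), T.share i.1 s q / T.Y i.1 s := by
    rw [sum_comm' (s' := fun s => S.filter fun j => T.join j ≤ s ∧ s ≤ j.1) (t' := range H)]
    · exact sum_congr rfl fun s _ => sum_comm
    · intro i s
      simp only [mem_Icc, mem_filter, mem_range]
      exact ⟨fun h => ⟨h, h.2.2.trans_lt (hH i h.1)⟩, fun h => h.1⟩
  have hsend : ∀ r ∈ T.eras S, ∀ s, r.1 < s → s < r.1 + T.l r.1 r.2 →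
      r.2 ∈ T.sending s ∧ s < H := fun r hr s h₁ h₂ => by
    obtain ⟨i, hi, rfl⟩ := mem_image.1 hr
    have hx := mem_extras.1 (hS hi)
    have h₃ := hx.join_add_le
    have h₄ := ((T.quiet_join i).mono le_rfl (by dsimp only at h₂; omega)).le_add h₁.le
    refine ⟨mem_filter.2 ⟨mem_univ _, ?_⟩, ?_⟩
    · dsimp only at h₁ h₂ h₄ ⊢
      omega
    · have := hH i hi
      dsimp only at h₂
      omega
  have h₂ : ∑ r ∈ T.eras S, ((T.l r.1 r.2 : ℝ) - 1) ≤
      ∑ s ∈ range H, ∑ q ∈ T.sending s,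
        ((((T.eras S).filter fun r => r.1 < s ∧ s < r.1 + T.l r.1 r.2).filter
          fun r => r.2 = q).card : ℝ) := by
    have h₃ : ∑ r ∈ T.eras S, (Ioo r.1 (r.1 + T.l r.1 r.2)).card =
        ∑ s ∈ range H, ∑ q ∈ T.sending s,
          (((T.eras S).filter fun r => r.1 < s ∧ s < r.1 + T.l r.1 r.2).filter
            fun r => r.2 = q).card := by
      simp_rw [card_eq_sum_ones (Ioo _ _)]
      rw [sum_comm' (s' := fun s => (T.eras S).filter
        fun r => r.1 < s ∧ s < r.1 + T.l r.1 r.2) (t' := range H)]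
      · refine sum_congr rfl fun s _ => ?_
        rw [← card_eq_sum_ones]
        refine card_eq_sum_card_fiberwise fun r hr => ?_
        rw [mem_coe, mem_filter] at hr
        exact (hsend r hr.1 s hr.2.1 hr.2.2).1
      · intro r s
        simp only [mem_Ioo, mem_filter, mem_range]
        exact ⟨fun h => ⟨h, (hsend r h.1 s h.2.1 h.2.2).2⟩, fun h => h.1⟩
    have h₄ : ∑ r ∈ T.eras S, ((T.l r.1 r.2 : ℝ) - 1) ≤
        ((∑ r ∈ T.eras S, (Ioo r.1 (r.1 + T.l r.1 r.2)).card : ℕ) : ℝ) := by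
      rw [Nat.cast_sum]
      refine sum_le_sum fun r _ => ?_
      rw [Nat.card_Ioo, sub_le_iff_le_add]
      exact_mod_cast (by omega : T.l r.1 r.2 ≤ r.1 + T.l r.1 r.2 - r.1 - 1 + 1)
    refine h₄.trans (le_of_eq ?_)
    rw [h₃]
    push_cast
    rfl
  rw [h₁]
  calc _ ≤ ∑ s ∈ range H, ∑ q ∈ T.sending s,
        (∑ i ∈ S.filter (fun j => T.join j ≤ s ∧ s ≤ j.1), T.share i.1 s q / T.Y i.1 s +
          1 / 2 * ((((T.eras S).filter fun r => r.1 < s ∧ s < r.1 + T.l r.1 r.2).filter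
            fun r => r.2 = q).card : ℝ)) := by
        simp only [sum_add_distrib, ← mul_sum]
        gcongr
    _ ≤ ∑ s ∈ range H, ∑ q ∈ T.sending s, (1 : ℝ) :=
        sum_le_sum fun s _ => sum_le_sum fun q _ => share_sum_le hS (hY s) q
    _ = _ := by simp

/-- Extras of one era have distinct transmission steps, all at least L after its start. As the
amount collected is increasing in that step, consecutive steps are the worst case, which `era_bound`
settles. -/
theorem card_le_collected {S : Finset (ℕ × Q)} (hS : S ⊆ T.extras)
    (hL : ∀ i ∈ S, 0 < T.l (T.join i) i.2) :
    1.41478 * (S.card : ℝ) ≤ ∑ i ∈ S, (1 / (T.l (T.join i) i.2 : ℝ) + 1 / 2 +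
        1 / 2 * Real.log (2 * ((i.1 : ℝ) - T.join i) / T.l (T.join i) i.2)) +
      1 / 2 * ∑ r ∈ T.eras S, ((T.l r.1 r.2 : ℝ) - 1) := by
  have hmaps : ∀ i ∈ S, (T.join i, i.2) ∈ T.eras S := fun i hi => mem_image_of_mem _ hi
  rw [card_eq_sum_card_fiberwise hmaps, ← sum_fiberwise_of_maps_to hmaps, mul_sum,
    ← sum_add_distrib]
  push_cast
  rw [mul_sum]
  refine sum_le_sum fun r hr => ?_
  have hLr : 0 < T.l r.1 r.2 := by
    obtain ⟨i, hi, rfl⟩ := mem_image.1 hr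
    exact hL i hi
  have hL0 : (0 : ℝ) < T.l r.1 r.2 := Nat.cast_pos.2 hLr
  set F := S.filter fun i => (T.join i, i.2) = r with hF
  have mem_F : ∀ i ∈ F, T.join i = r.1 ∧ i.2 = r.2 ∧ r.1 + T.l r.1 r.2 ≤ i.1 := fun i hi => by
    obtain ⟨h₁, rfl⟩ := mem_filter.1 hi
    exact ⟨rfl, rfl, (mem_extras.1 (hS h₁)).join_add_le⟩
  set f : ℕ → ℝ := fun d => 1 / (T.l r.1 r.2 : ℝ) + 1 / 2 +
    1 / 2 * Real.log (2 * ((d : ℝ) - r.1) / T.l r.1 r.2) with hf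
  have hinj : Set.InjOn Prod.fst (F : Set (ℕ × Q)) := fun i hi j hj hij =>
    Prod.ext hij ((mem_F i hi).2.1.trans (mem_F j hj).2.1.symm)
  have h₁ : ∑ i ∈ F, (1 / (T.l (T.join i) i.2 : ℝ) + 1 / 2 +
        1 / 2 * Real.log (2 * ((i.1 : ℝ) - T.join i) / T.l (T.join i) i.2)) =
      ∑ d ∈ F.image Prod.fst, f d := by
    rw [sum_image hinj]
    refine sum_congr rfl fun i hi => ?_
    rw [(mem_F i hi).1, (mem_F i hi).2.1]
  have h₂ := sum_range_add_le_sum (f := f) (r.1 + T.l r.1 r.2) (fun m n hm hmn => by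
      have h₁ : ((r.1 : ℝ) + T.l r.1 r.2) ≤ m := by exact_mod_cast hm
      have h₂ : (m : ℝ) ≤ n := by exact_mod_cast hmn
      have h₃ : 0 < 2 * ((m : ℝ) - r.1) / T.l r.1 r.2 := div_pos (by linarith) hL0
      simp only [hf]
      gcongr) (F.image Prod.fst) fun d hd => by
    obtain ⟨i, hi, rfl⟩ := mem_image.1 hd
    exact (mem_F i hi).2.2
  rw [card_image_of_injOn hinj] at h₂
  have h₃ := era_bound (x := F.card) hLr
  rw [h₁]
  refine h₃.trans (add_le_add (le_trans (le_of_eq ?_) h₂) le_rfl)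
  refine sum_congr rfl fun k _ => ?_
  simp only [hf]
  congr 4
  push_cast
  ring

theorem card_sending_add_extras :
    ∑ t ∈ range H, (univ.filter fun q => 0 < T.o t q).card + T.idles.card =
      ∑ t ∈ range H, (T.sending t).card + T.extras.card := by
  have h₁ : T.idles.card = ∑ t ∈ range H, (univ.filter fun q => T.Idle t q).card := by
    rw [idles, card_filter, sum_product]
    exact sum_congr rfl fun t _ => (card_filter _ _).symm
  have h₂ : T.extras.card = ∑ t ∈ range H, (univ.filter fun q => T.Extra t q).card := by
    rw [extras, card_filter, sum_product]
    exact sum_congr rfl fun t _ => (card_filter _ _).symm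
  rw [h₁, h₂, ← sum_add_distrib, ← sum_add_distrib]
  refine sum_congr rfl fun t _ => ?_
  simp only [sending, card_filter, ← sum_add_distrib]
  refine sum_congr rfl fun q _ => ?_
  unfold Idle Extra
  split_ifs <;> omega

variable (T) in
theorem throughput_le :
    1.41478 * ((∑ t ∈ range H, (univ.filter fun q => 0 < T.o t q).card : ℕ) : ℝ) ≤
    (1.41478 + 1) * ((∑ t ∈ range H, (univ.filter fun q => 0 < T.l t q).card : ℕ) : ℝ) := by
  rcases isEmpty_or_nonempty Q with hQ | hQ
  · simp
  obtain ⟨S, hS, K, hK, g, hg, hinj, hcard, hmatch⟩ :=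
    exists_greedy_matching T.extras T.idles T.join T.Elig
  have hY : ∀ s, ∀ i ∈ S, T.join i ≤ s → s ≤ i.1 →
      ((S.filter fun j => T.join j ≤ s ∧ s ≤ j.1).card : ℝ) ≤ T.Y i.1 s :=
    fun s i hi h₁ h₂ => card_alive_le hS hg hinj hmatch hi h₁ h₂
  have hY1 : ∀ i ∈ S, ∀ s, T.join i ≤ s → s ≤ i.1 → 1 ≤ T.Y i.1 s := fun i hi s h₁ h₂ => by
    refine le_trans ?_ (hY s i hi h₁ h₂)
    have : 0 < (S.filter fun j => T.join j ≤ s ∧ s ≤ j.1).card :=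
      card_pos.2 ⟨i, mem_filter.2 ⟨hi, h₁, h₂⟩⟩
    exact_mod_cast this
  have h₁ := card_le_collected hS fun i hi =>
    ((mem_extras.1 (hS hi)).level_join (hY1 i hi _ le_rfl (T.join_le i))).1
  have h₂ := sum_le_sum fun i hi => (mem_extras.1 (hS hi)).collected (hY1 i hi)
  have h₃ := payments_le hS hY
  have h₄ := T.card_sending_add_extras
  have h₅ := card_le_card hK
  have h₆ : ∑ t ∈ range H, (univ.filter fun q => 0 < T.o t q).card ≤
    ∑ t ∈ range H, (T.sending t).card + S.card := by omega
  have h₇ : ((∑ t ∈ range H, (univ.filter fun q => 0 < T.o t q).card : ℕ) : ℝ) ≤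
    ((∑ t ∈ range H, (T.sending t).card : ℕ) : ℝ) + S.card := by exact_mod_cast h₆
  rw [← Nat.cast_sum] at h₃
  change _ ≤ (1.41478 + 1) * ((∑ t ∈ range H, (T.sending t).card : ℕ) : ℝ)
  linarith

end Trace
end Payments

/-! ### From actual runs to traces, and infinite inputs. -/

section Runs
variable {Q : Type}

/-- The buffer before the arrivals of a time step. -/
def before (b : ℕ → Buffer Q) : ℕ → Buffer Q
  | 0 => 0
  | t + 1 => transmit (b t)

theorem IsRun.step {R : AdmissionRule Q} {I : Instance Q} {b : ℕ → Buffer Q} (h : IsRun R I b) :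
    ∀ t, Admit R (before b t) (I t) (b t)
  | 0 => h.1
  | t + 1 => h.2 t

variable [Fintype Q]

theorem sum_transmit_le (s : Buffer Q) : ∑ p, transmit s p ≤ ∑ p, s p :=
  Finset.sum_le_sum fun _ _ => Nat.sub_le _ _

theorem IsRun.sum_le {R : AdmissionRule Q} {I : Instance Q} {b : ℕ → Buffer Q} {M : ℕ}
    (h : IsRun R I b)
    (hR : ∀ s I s', Admit R s I s' → ∑ p, s p ≤ M → ∑ p, s' p ≤ M) (t : ℕ) :
    ∑ p, before b t p ≤ M ∧ ∑ p, b t p ≤ M := by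
  induction t with
  | zero =>
    have : ∑ p, before b 0 p ≤ M := by simp [before]
    exact ⟨this, hR _ _ _ (h.step 0) this⟩
  | succ t ih =>
    have : ∑ p, before b (t + 1) p ≤ M := (sum_transmit_le _).trans ih.2
    exact ⟨this, hR _ _ _ (h.step (t + 1)) this⟩

theorem throughput_eq {b : ℕ → Buffer Q} {H : ℕ} (h : ∀ t q, H ≤ t → b t q = 0) :
    throughput b =
      ((∑ t ∈ Finset.range H, (Finset.univ.filter fun q => 0 < b t q).card : ℕ) : ℝ≥0∞) := by
  rw [throughput, tsum_eq_sum (s := Finset.range H), Nat.cast_sum]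
  intro t ht
  rw [Finset.mem_range, not_lt] at ht
  simp [h t _ ht]

theorem exists_forall_eq_zero {b : ℕ → Buffer Q} (h : throughput b ≠ ⊤) :
    ∃ H, ∀ t q, H ≤ t → b t q = 0 := by
  have h₁ := ENNReal.tendsto_atTop_zero_of_tsum_ne_top h
  have h₂ := h₁.eventually_lt_const zero_lt_one
  -- The summands are integers tending to zero, so they vanish eventually.
  obtain ⟨H, hH⟩ := Filter.eventually_atTop.1 h₂
  refine ⟨H, fun t q ht => ?_⟩
  have h₃ : (Finset.univ.filter fun q => 0 < b t q).card < 1 := by exact_mod_cast hH t ht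
  rw [Nat.lt_one_iff, Finset.card_eq_zero, Finset.filter_eq_empty_iff] at h₃
  have := h₃ (Finset.mem_univ q)
  omega

variable [DecidableEq Q] {M : ℕ} {I : Instance Q} {b o : ℕ → Buffer Q}

/-- The joint evolution of the buffers of Longest Queue Drop and another algorithm. -/
def IsRun.trace (hb : IsRun (lqd M) I b) (ho : IsRun (feasible M) I o) {H : ℕ}
    (hfin : ∀ t q, H ≤ t → b t q = 0 ∧ o t q = 0) : Trace Q M H where
  l := b
  o := o
  dr t q := b t q < before b t q + (I t).count q
  init q h := by
    have := (ho.step 0).le_add_count feasible_le q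
    simp only [before] at h this
    omega
  decay t q h := by
    simp only [before, transmit] at h
    omega
  lead t q h := by
    have := (ho.step (t + 1)).le_add_count feasible_le q
    simp only [before, transmit] at h this
    omega
  full t q h := (hb.step t).lqd_dropped (hb.sum_le (fun _ _ _ h => h.lqd_sum_le) t).1 h
  cap t := (ho.sum_le (fun _ _ _ h => h.feasible_sum_le) t).2
  fin := hfin

/-- Once Longest Queue Drop has stopped transmitting, any other buffer runs empty as well. -/
theorem IsRun.eq_zero_of_lqd_eq_zero (hb : IsRun (lqd M) I b) (ho : IsRun (feasible M) I o)
    {H : ℕ} (h : ∀ t q, H ≤ t → b t q = 0) (t : ℕ) (q : Q) (ht : H + M ≤ t) : o t q = 0 := by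
  have hle : ∀ t, o t q ≤ M := fun t =>
    (Finset.single_le_sum (fun _ _ => Nat.zero_le _) (Finset.mem_univ q)).trans
      (ho.sum_le (fun _ _ _ h => h.feasible_sum_le) t).2
  rcases Nat.eq_zero_or_pos M with hM | hM
  · have := hle t
    omega
  have hI : ∀ t, H ≤ t → I t = [] := fun t ht => by
    by_contra hne
    have := (hb.step t).lqd_count (hb.sum_le (fun _ _ _ h => h.lqd_sum_le) t).1 hM hne
    simp [h t _ ht] at this
  have key : ∀ k, o (H + k) q ≤ M - k := by
    intro k
    induction k with
    | zero => exact hle H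
    | succ k ih =>
      have h₁ := (ho.step (H + k + 1)).le_add_count feasible_le q
      rw [hI _ (by omega)] at h₁
      simp only [before, transmit, List.count_nil] at h₁
      rw [← add_assoc]
      omega
  have := key (t - H)
  rw [show H + (t - H) = t by omega] at this
  omega

theorem IsRun.opt_le (hb : IsRun (lqd M) I b) :
    opt M I ≤ ENNReal.ofReal (1 + 1 / 1.41478) * throughput b := by
  by_cases htop : throughput b = ⊤
  · rw [htop, ENNReal.mul_top (ENNReal.ofReal_pos.2 (by norm_num)).ne']
    exact le_top
  refine iSup₂_le fun o ho => ?_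
  obtain ⟨H, hH⟩ := exists_forall_eq_zero htop
  have hH' : ∀ t q, H + M ≤ t → b t q = 0 ∧ o t q = 0 := fun t q ht =>
    ⟨hH t q (by omega), hb.eq_zero_of_lqd_eq_zero ho hH t q ht⟩
  have key := (hb.trace ho hH').throughput_le
  rw [throughput_eq fun t q ht => (hH' t q ht).1, throughput_eq fun t q ht => (hH' t q ht).2,
    ← ENNReal.ofReal_natCast, ← ENNReal.ofReal_natCast, ← ENNReal.ofReal_mul (by norm_num)]
  refine ENNReal.ofReal_le_ofReal ?_
  have h₁ : (1 + 1 / 1.41478 : ℝ) = (1.41478 + 1) / 1.41478 := by norm_num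
  rw [h₁, div_mul_eq_mul_div, le_div_iff₀ (by norm_num), mul_comm]
  exact key

theorem LQDCompetitive.mono {c c' : ℝ} (h : LQDCompetitive c) (hc : c ≤ c') : LQDCompetitive c' :=
  ⟨h.1.trans hc, fun N M I b hb => (h.2 N M I b hb).trans
    (mul_le_mul_left (ENNReal.ofReal_le_ofReal hc) _)⟩

end Runs

end SharedMemorySwitch

theorem theorem1 :
    SharedMemorySwitch.LQDCompetitive 1.707 ∧
    SharedMemorySwitch.LQDCompetitive (1 + 1 / 1.41478) ∧
    (1 + 1 / 1.41478 : ℝ) ≤ 1.70683 ∧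
    (1.70683 : ℝ) < 1 + 1 / Real.sqrt 2 := by
  have h : SharedMemorySwitch.LQDCompetitive (1 + 1 / 1.41478) :=
    ⟨by norm_num, fun _ _ _ _ hb => hb.opt_le⟩
  refine ⟨h.mono (by norm_num), h, by norm_num, ?_⟩
  have h₂ : Real.sqrt 2 < 1 / 0.70683 := (Real.sqrt_lt' (by norm_num)).2 (by norm_num)
  have h₃ := one_div_lt_one_div_of_lt (Real.sqrt_pos.2 two_pos) h₂
  rw [one_div_one_div] at h₃
  linarith
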